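/- Let $n\ge 2$. Let $\hat{\mathbb E}^n=\mathbb E^n\cup\{\infty\}$ with coordinates $x_0,\dots,x_{n-1}$; spheres in $\hat{\mathbb E}^n$ are round spheres of positive diameter and hyperplanes (together with $\infty$). A *kissing sphere* is a sphere contained in $\{x_0\ge 0\}\cup\{\infty\}$ that meets $\{x_0=0\}\cup\{\infty\}$ in exactly one point (possibly $\infty$), its tangent point $\mathbf t(p)$; $\phi(p)\in(0,\infty]$ denotes its diameter. Let $\mathbb K^n$ be the set of kissing spheres. For $p,q\in\mathbb K^n$ put $d_K(p,q)=\|\mathbf t(Tp)-\mathbf t(Tq)\|$ if there is a Möbius transformation $T$ of $\hat{\mathbb E}^n$ (an element of the group generated by inversions in spheres and reflections in hyperplanes) preserving the half-space $\{x_0\le 0\}\cup\{\infty\}$ such that $\phi(Tp)=\phi(Tq)=1$ (the value does not depend on $T$), and $d_K(p,q)=0$ if no such $T$ exists. **Theorem 3.1.** Let $I$ be a finite non-empty set and $d:I\times I\to\mathbb R_{\ge 0}$ a symmetric function with $d(i,i)=0$ for all $i\in I$. For $J\subseteq I$ let $D_J=(d(i,j)^2)_{i,j\in J}$. Consider the statements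 (i) $(I,d)$ embeds isometrically into $(\mathbb K^n,d_K)$, that is, there is a map $\sigma:I\to\mathbb K^n$ (not necessarily injective) with $d_K(\sigma(i),\sigma(j))=d(i,j)$ for all $i,j\in I$; (ii) $(-1)^{|J|}\det D_J\le 0$ for every non-empty $J\subseteq I$, and $\operatorname{rank} D_I\le n+1$; (iii) $D_I$ has, counted with multiplicity, exactly one positive eigenvalue and at most $n$ negative eigenvalues. If for every $i\in I$ there is $j\in I$ with $d(i,j)\neq 0$, then (i), (ii) and (iii) are equivalent. Moreover, without this assumption: (i) implies (ii); if $d$ is not identically zero, then (ii) and (iii) are equivalent; and if $d$ is identically zero, then (i) and (ii) both hold. -/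

import Mathlib

open scoped RealInnerProductSpace

noncomputable section

namespace KissingSpheres

/-- Euclidean `n`-space, with coordinates `x 0, …, x (n - 1)`. -/
abbrev E (n : ℕ) : Type := EuclideanSpace ℝ (Fin n)

/-- Extended Euclidean `n`-space, i.e. Euclidean `n`-space together with one point at infinity. -/
abbrev EHat (n : ℕ) : Type := OnePoint (E n)

/-! ### Spheres -/

/-- The sphere with the given centre and diameter `φ`. -/
def roundSphere {n : ℕ} (c : E n) (φ : ℝ) : Set (EHat n) :=
  {y | ∃ x : E n, y = ↑x ∧ dist x c = φ / 2}

/-- The hyperplane `⟪a, x⟫ = b`, which as a subset of the extended space contains infinity. -/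
def hyperplane {n : ℕ} (a : E n) (b : ℝ) : Set (EHat n) :=
  {y | y = OnePoint.infty ∨ ∃ x : E n, y = ↑x ∧ ⟪a, x⟫ = b}

/-- Spheres of the extended space: round spheres of positive diameter, and hyperplanes. -/
def IsSphere {n : ℕ} (S : Set (EHat n)) : Prop :=
  (∃ (c : E n) (φ : ℝ), 0 < φ ∧ S = roundSphere c φ) ∨
    ∃ (a : E n) (b : ℝ), ‖a‖ = 1 ∧ S = hyperplane a b

/-- The reference hyperplane `x 0 = 0`, with infinity. -/
def boundary (n : ℕ) [NeZero n] : Set (EHat n) :=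
  {y | y = OnePoint.infty ∨ ∃ x : E n, y = ↑x ∧ x 0 = 0}

/-- The closed half-space `0 ≤ x 0`, with infinity. -/
def upperHalfSpace (n : ℕ) [NeZero n] : Set (EHat n) :=
  {y | y = OnePoint.infty ∨ ∃ x : E n, y = ↑x ∧ 0 ≤ x 0}

/-- The closed half-space `x 0 ≤ 0`, with infinity (the reference ball). -/
def lowerHalfSpace (n : ℕ) [NeZero n] : Set (EHat n) :=
  {y | y = OnePoint.infty ∨ ∃ x : E n, y = ↑x ∧ x 0 ≤ 0}

/-- A kissing sphere: a sphere contained in the half-space `0 ≤ x 0` that meets the hyperplane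
`x 0 = 0` in exactly one point (possibly infinity). -/
structure KissingSphere (n : ℕ) [NeZero n] where
  carrier : Set (EHat n)
  isSphere : IsSphere carrier
  subset_upper : carrier ⊆ upperHalfSpace n
  tangent : ∃ t, carrier ∩ boundary n = {t}

/-- The tangent point of a kissing sphere. -/
def KissingSphere.tangentPoint {n : ℕ} [NeZero n] (p : KissingSphere n) : EHat n :=
  p.tangent.choose

/-- The diameter of a kissing sphere, as the supremum of the distances between its finite
points; it is infinite for hyperplanes (in ambient dimension at least two). -/
def KissingSphere.diameter {n : ℕ} [NeZero n] (p : KissingSphere n) : ENNReal :=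
  Metric.ediam {x : E n | (x : EHat n) ∈ p.carrier}

/-! ### Möbius transformations -/

open Classical in
/-- Inversion of the extended space in the sphere of centre `c` and radius `r`, as a function. -/
def inversionFun {n : ℕ} (c : E n) (r : ℝ) : EHat n → EHat n
  | OnePoint.infty => ↑c
  | OnePoint.some x =>
      if x = c then OnePoint.infty else ↑(EuclideanGeometry.inversion c r x)

theorem inversionFun_involutive {n : ℕ} (c : E n) (r : ℝ) (hr : r ≠ 0) :
    Function.Involutive (inversionFun c r) := by
  intro y
  induction y using OnePoint.rec with
  | infty => simp [inversionFun]
  | coe x =>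
    by_cases h : x = c
    · simp [inversionFun, h]
    · have h2 : EuclideanGeometry.inversion c r x ≠ c := by
        rwa [Ne, EuclideanGeometry.inversion_eq_center hr]
      simp [inversionFun, h, h2, EuclideanGeometry.inversion_inversion c hr]

/-- Inversion of the extended space in the sphere of centre `c` and radius `r`: it exchanges `c`
and infinity, and maps any other `x` to the point `c + (r / dist x c) ^ 2 • (x - c)`. -/
def sphereInversion {n : ℕ} (c : E n) (r : ℝ) (hr : r ≠ 0) : Equiv.Perm (EHat n) :=
  (inversionFun_involutive c r hr).toPerm

/-- Reflection of the extended space in the hyperplane `⟪a, x⟫ = b` with unit normal `a`, as a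
function; it fixes infinity. -/
def reflectionFun {n : ℕ} (a : E n) (b : ℝ) : EHat n → EHat n
  | OnePoint.infty => OnePoint.infty
  | OnePoint.some x => ↑(x - (2 * (⟪a, x⟫ - b)) • a)

theorem reflectionFun_involutive {n : ℕ} (a : E n) (b : ℝ) (ha : ‖a‖ = 1) :
    Function.Involutive (reflectionFun a b) := by
  intro y
  induction y using OnePoint.rec with
  | infty => rfl
  | coe x =>
    have h : ⟪a, a⟫ = (1 : ℝ) := by simp [ha]
    simp only [reflectionFun, OnePoint.coe_eq_coe, inner_sub_right, inner_smul_right, h]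
    module

/-- Reflection of the extended space in the hyperplane `⟪a, x⟫ = b` with unit normal `a`. -/
def hyperplaneReflection {n : ℕ} (a : E n) (b : ℝ) (ha : ‖a‖ = 1) : Equiv.Perm (EHat n) :=
  (reflectionFun_involutive a b ha).toPerm

/-- The (general) Möbius group of the extended space: the group generated by the inversions in
spheres and the reflections in hyperplanes. -/
def moebiusGroup (n : ℕ) : Subgroup (Equiv.Perm (EHat n)) :=
  Subgroup.closure
    ({T | ∃ (c : E n) (r : ℝ) (hr : r ≠ 0), T = sphereInversion c r hr} ∪
      {T | ∃ (a : E n) (b : ℝ) (ha : ‖a‖ = 1), T = hyperplaneReflection a b ha})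

/-! ### The distance of kissing spheres -/

/-- Some Möbius transformation preserving the half-space `x 0 ≤ 0` maps `p` and `q` to kissing
spheres of diameter one whose tangent points have Euclidean distance `δ`. -/
def IsNormalizedDist {n : ℕ} [NeZero n] (p q : KissingSphere n) (δ : ℝ) : Prop :=
  ∃ T ∈ moebiusGroup n, T '' lowerHalfSpace n = lowerHalfSpace n ∧
    ∃ p' q' : KissingSphere n,
      T '' p.carrier = p'.carrier ∧ T '' q.carrier = q'.carrier ∧
      p'.diameter = 1 ∧ q'.diameter = 1 ∧
      ∃ x y : E n, p'.tangentPoint = ↑x ∧ q'.tangentPoint = ↑y ∧ δ = dist x y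

open Classical in
/-- The distance of two kissing spheres: normalize both by a Möbius transformation preserving
`x 0 ≤ 0` so that they have diameter one, and take the Euclidean distance of the tangent points;
it is zero if this is not possible. -/
def dK {n : ℕ} [NeZero n] (p q : KissingSphere n) : ℝ :=
  if h : ∃ δ, IsNormalizedDist p q δ then h.choose else 0

/-- `(I, d)` is isometrically embeddable into the space of kissing spheres. (An isometric
embedding is a distance-preserving map; it need not be injective.) -/
def IsometricallyEmbeddable {I : Type*} (d : I → I → ℝ) (n : ℕ) [NeZero n] : Prop :=
  ∃ σ : I → KissingSphere n, ∀ i j, dK (σ i) (σ j) = d i j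

/-! ### Distance matrices -/

/-- The matrix of squared distances. -/
def distMatrix {I : Type*} (d : I → I → ℝ) : Matrix I I ℝ :=
  Matrix.of fun i j => d i j ^ 2

theorem distMatrix_isHermitian {I : Type*} (d : I → I → ℝ) (hsymm : ∀ i j, d i j = d j i) :
    (distMatrix d).IsHermitian := by
  ext i j
  simp [distMatrix, hsymm j i]

/-- For every nonempty `J`, `(-1) ^ |J| * det D_J ≤ 0`, where `D_J` is the distance matrix
of `J`; and the rank of the whole distance matrix is at most `n + 1`. -/
def DeterminantCondition {I : Type*} [Fintype I] [DecidableEq I] (d : I → I → ℝ) (n : ℕ) : Prop :=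
  (∀ J : Finset I, J.Nonempty →
      (-1 : ℝ) ^ J.card * (distMatrix fun i j : J => d i j).det ≤ 0) ∧
    (distMatrix d).rank ≤ n + 1

/-- The distance matrix has, counted with multiplicity, exactly one positive eigenvalue and at
most `n` negative eigenvalues. -/
def EigenvalueCondition {I : Type*} [Fintype I] [DecidableEq I] (d : I → I → ℝ)
    (hsymm : ∀ i j, d i j = d j i) (n : ℕ) : Prop :=
  (Finset.univ.filter fun i => 0 < (distMatrix_isHermitian d hsymm).eigenvalues i).card = 1 ∧
    (Finset.univ.filter fun i => (distMatrix_isHermitian d hsymm).eigenvalues i < 0).card ≤ n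

end KissingSpheres

end

/-! The proof passes to Lorentzian geometry. A sphere or half-space is recorded by the function `a *
‖x‖ ^ 2 + b - 2 * ⟪w, x⟫`, a vector of a space of signature (1, n+1), and Möbius transformations
lift to isometries of that space (`exists_isLift`). Let h be the vector of the half-space `x 0 ≤ 0`.
Kissing spheres are the zero sets of v - h, with v orthogonal to h and in the future light cone of
the orthogonal complement of h, which has signature (1, n). For diameters one, the product of v and
u is the squared distance of the tangent points. An isometry that fixes h preserves this product,
and a nonzero product allows normalization by one inversion. Hence d_K² is the product of light-like
vectors (`dK_sq`).

So (i) says that D is a Gram matrix of future light-like vectors in signature (1, n). Such a matrix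
has rank at most n+1 and is nonpositive on a hyperplane, hence each principal submatrix has at most
one positive eigenvalue. Since its trace is zero, this fixes the sign of its determinant, which is
(ii).

From (ii) to (iii): the principal minors are, up to sign, summed in the coefficients of the
characteristic polynomial, and Descartes' rule of signs leaves at most one positive eigenvalue.
Trace zero and D ≠ 0 give at least one, and the rank bounds the negative ones.

From (iii) to (i): the spectral decomposition gives Gram vectors, isotropic because D has zero
diagonal. As the entries are nonnegative and no row vanishes, they are nonzero and lie in a single
cone (`exists_future_gram`). -/

namespace KissingSpheres

/-! ### Principal minors, determinants and positive eigenvalues -/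

open Polynomial in
/-- A polynomial without positive coefficients has no sign variations. -/
theorem signVariations_eq_zero_of_coeff_nonpos (P : ℝ[X]) (hP : ∀ k, P.coeff k ≤ 0) :
    P.signVariations = 0 := by
  induction h : P.support.card using Nat.strong_induction_on generalizing P with
  | _ m ih =>
    by_cases h0 : P = 0
    · simp [h0]
    have hE : ∀ k, P.eraseLead.coeff k ≤ 0 := fun k => by
      rw [eraseLead_coeff]; split_ifs
      exacts [le_rfl, hP k]
    have hlead : P.leadingCoeff < 0 :=
      lt_of_le_of_ne (hP _) (leadingCoeff_ne_zero.2 h0)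
    rw [signVariations_eq_eraseLead_add_ite h0,
      ih _ (h ▸ eraseLead_support_card_lt h0) _ hE rfl, if_neg]
    rw [sign_neg hlead]
    rcases (hE P.eraseLead.natDegree).lt_or_eq with h1 | h1
    · rw [show P.eraseLead.leadingCoeff = P.eraseLead.coeff P.eraseLead.natDegree from rfl,
        sign_neg h1]; decide
    · rw [show P.eraseLead.leadingCoeff = P.eraseLead.coeff P.eraseLead.natDegree from rfl, h1,
        sign_zero]; decide

open Polynomial in
/-- A polynomial whose non-leading coefficients are nonpositive has at most one positive root,
counted with multiplicity. -/
theorem countP_roots_pos_le_one {P : ℝ[X]}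
    (hcoeff : ∀ k < P.natDegree, P.coeff k ≤ 0) : P.roots.countP (0 < ·) ≤ 1 := by
  -- Descartes' rule of signs; the leading term adds at most one variation to those of the rest.
  refine (roots_countP_pos_le_signVariations P).trans ?_
  refine (signVariations_le_eraseLead_succ P).trans ?_
  rw [signVariations_eq_zero_of_coeff_nonpos]
  intro k
  rw [eraseLead_coeff]
  split_ifs with h
  · exact le_rfl
  · rcases lt_or_gt_of_ne h with h | h
    · exact hcoeff k h
    · exact (coeff_eq_zero_of_natDegree_lt h).le

variable {I : Type*} [Fintype I] [DecidableEq I]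

/-- If all principal minors `A_J` satisfy `(-1) ^ |J| * det A_J ≤ 0`, then a Hermitian matrix `A`
has at most one positive eigenvalue. -/
theorem card_pos_eigenvalues_le_one_of_minors {A : Matrix I I ℝ} (hA : A.IsHermitian)
    (h : ∀ J : Finset I, J.Nonempty → (-1 : ℝ) ^ J.card *
      (A.submatrix (Subtype.val : J → I) (Subtype.val : J → I)).det ≤ 0) :
    (Finset.univ.filter fun i => 0 < hA.eigenvalues i).card ≤ 1 := by
  -- The coefficient of degree |I| - m is (-1)^m times the sum of the principal minors of size m.
  have key := countP_roots_pos_le_one (P := A.charpoly) (fun k hk => by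
    rw [A.charpoly_natDegree_eq_dim] at hk
    obtain ⟨m, hm⟩ := Nat.exists_eq_add_of_lt hk
    have : k = Fintype.card I - (m + 1) := by omega
    rw [this, A.charpoly_coeff_eq_sum_minors (m + 1) (by omega), Finset.mul_sum]
    refine Finset.sum_nonpos fun J hJ => ?_
    have hc := (Finset.mem_powersetCard.1 hJ).2
    have := h J (Finset.card_pos.1 (by omega))
    rwa [hc] at this)
  rw [hA.roots_charpoly_eq_eigenvalues, Multiset.countP_map] at key
  simpa [Finset.card, Finset.filter] using key

/-- A quadratic form that is nonpositive on a hyperplane (or everywhere). -/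
def NonposOnHyperplane {J : Type*} [Fintype J] (A : Matrix J J ℝ) : Prop :=
  ∃ l : J → ℝ, ∀ x : J → ℝ, l ⬝ᵥ x = 0 → x ⬝ᵥ A.mulVec x ≤ 0

theorem NonposOnHyperplane.submatrix {A : Matrix I I ℝ} (hA : NonposOnHyperplane A)
    (J : Finset I) :
    NonposOnHyperplane (A.submatrix (Subtype.val : J → I) (Subtype.val : J → I)) := by
  obtain ⟨l, hl⟩ := hA
  refine ⟨fun j => l j, fun x hx => ?_⟩
  have ext_sum : ∀ f : I → ℝ, ∑ i, f i * (if h : i ∈ J then x ⟨i, h⟩ else 0) =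
      ∑ j : J, f j * x j := by
    intro f
    rw [← Finset.sum_subset (Finset.subset_univ J), ← Finset.sum_coe_sort J]
    · simp
    · intro i _ hi; simp [hi]
  have := hl (fun i => if h : i ∈ J then x ⟨i, h⟩ else 0) (by
    rw [dotProduct, ext_sum]; exact hx)
  simp only [dotProduct, Matrix.mulVec, ext_sum] at this
  simp only [mul_comm (dite _ _ _)] at this
  rw [ext_sum] at this
  simpa only [dotProduct, Matrix.mulVec, Matrix.submatrix_apply, mul_comm (x _)] using this

/-- Two eigenvectors with positive eigenvalues would span a plane on which the form is positive
definite, but every plane meets the hyperplane nontrivially. -/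
theorem card_pos_eigenvalues_le_one {A : Matrix I I ℝ} (hA : A.IsHermitian)
    (h : NonposOnHyperplane A) :
    (Finset.univ.filter fun i => 0 < hA.eigenvalues i).card ≤ 1 := by
  obtain ⟨l, hl⟩ := h
  refine Finset.card_le_one.2 fun i hi j hj => ?_
  by_contra hij
  simp only [Finset.mem_filter, Finset.mem_univ, true_and] at hi hj
  set u : I → ℝ := ⇑(hA.eigenvectorBasis i) with hu
  set v : I → ℝ := ⇑(hA.eigenvectorBasis j) with hv
  have hAu : A.mulVec u = hA.eigenvalues i • u := hA.mulVec_eigenvectorBasis i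
  have hAv : A.mulVec v = hA.eigenvalues j • v := hA.mulVec_eigenvectorBasis j
  have orth : ∀ a b : I, (⇑(hA.eigenvectorBasis a) : I → ℝ) ⬝ᵥ ⇑(hA.eigenvectorBasis b) =
      if b = a then 1 else 0 := fun a b => by
    rw [← orthonormal_iff_ite.1 hA.eigenvectorBasis.orthonormal b a,
      EuclideanSpace.inner_eq_star_dotProduct]
    simp
  have huu : u ⬝ᵥ u = 1 := by rw [hu, orth]; simp
  have hvv : v ⬝ᵥ v = 1 := by rw [hv, orth]; simp
  have huv : u ⬝ᵥ v = 0 := by rw [hu, hv, orth]; simp [Ne.symm hij]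
  have hvu : v ⬝ᵥ u = 0 := by rw [hu, hv, orth]; simp [hij]
  have key : ∀ a b : ℝ, a * (l ⬝ᵥ u) + b * (l ⬝ᵥ v) = 0 →
      a ^ 2 * hA.eigenvalues i + b ^ 2 * hA.eigenvalues j ≤ 0 := by
    intro a b hab
    have := hl (a • u + b • v) (by simpa [dotProduct_add] using hab)
    simp only [Matrix.mulVec_add, Matrix.mulVec_smul, hAu, hAv, dotProduct_add, add_dotProduct,
      smul_dotProduct, dotProduct_smul, huu, hvv, huv, hvu, smul_eq_mul] at this
    nlinarith
  by_cases h0 : l ⬝ᵥ v = 0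
  · have := key 0 1 (by simp [h0])
    simp only [one_pow, one_mul] at this
    nlinarith
  · have := key (l ⬝ᵥ v) (-(l ⬝ᵥ u)) (by ring)
    have h1 : 0 < (l ⬝ᵥ v) ^ 2 := by positivity
    nlinarith [mul_pos h1 hi, mul_nonneg (sq_nonneg (-(l ⬝ᵥ u))) hj.le]

/-- The spectral decomposition of a real Hermitian matrix, entrywise. -/
theorem apply_eq_sum_eigenvalues {A : Matrix I I ℝ} (hA : A.IsHermitian) (i j : I) :
    A i j = ∑ k, hA.eigenvalues k * (hA.eigenvectorBasis k i * hA.eigenvectorBasis k j) := by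
  conv_lhs => rw [hA.spectral_theorem, Unitary.conjStarAlgAut_apply]
  rw [Matrix.mul_apply]
  simp only [Matrix.mul_diagonal, Matrix.star_apply, Matrix.IsHermitian.eigenvectorUnitary_apply]
  refine Finset.sum_congr rfl fun k _ => ?_
  simp
  ring

/-- The hyperplane is the orthogonal complement of the only eigenvector with positive eigenvalue. -/
theorem nonposOnHyperplane_of_card_eq_one {A : Matrix I I ℝ} (hA : A.IsHermitian)
    (h : (Finset.univ.filter fun i => 0 < hA.eigenvalues i).card = 1) :
    NonposOnHyperplane A := by
  obtain ⟨k₀, hk₀⟩ := Finset.card_eq_one.1 h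
  refine ⟨fun i => hA.eigenvectorBasis k₀ i, fun x hx => ?_⟩
  have : x ⬝ᵥ A.mulVec x =
      ∑ k, hA.eigenvalues k * (∑ i, hA.eigenvectorBasis k i * x i) ^ 2 := by
    simp only [dotProduct, Matrix.mulVec, apply_eq_sum_eigenvalues hA, sq, Finset.sum_mul,
      Finset.mul_sum]
    rw [Finset.sum_comm_cycle]
    refine Finset.sum_congr rfl fun k _ => Finset.sum_congr rfl fun a _ =>
      Finset.sum_congr rfl fun b _ => ?_
    ring
  rw [this]
  refine Finset.sum_nonpos fun k _ => ?_
  by_cases hk : k = k₀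
  · subst hk
    have h0 : ∑ i, hA.eigenvectorBasis k i * x i = 0 := hx
    simp [h0]
  · have : k ∉ Finset.univ.filter fun i => 0 < hA.eigenvalues i := by
      rw [hk₀]; simpa using hk
    simp only [Finset.mem_filter, Finset.mem_univ, true_and, not_lt] at this
    exact mul_nonpos_of_nonpos_of_nonneg this (sq_nonneg _)

/-- The sign of the determinant of a traceless matrix with at most one positive eigenvalue. -/
theorem neg_one_pow_card_mul_det_nonpos [Nonempty I] {A : Matrix I I ℝ} (hA : A.IsHermitian)
    (htr : A.trace = 0)
    (h : (Finset.univ.filter fun i => 0 < hA.eigenvalues i).card ≤ 1) :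
    (-1 : ℝ) ^ Fintype.card I * A.det ≤ 0 := by
  have hdet : A.det = ∏ i, hA.eigenvalues i := by simpa using hA.det_eq_prod_eigenvalues
  have hsum : ∑ i, hA.eigenvalues i = 0 := by
    rw [← htr]; simpa using hA.trace_eq_sum_eigenvalues.symm
  -- Without a zero eigenvalue, trace zero forces a positive one, so exactly one; then the product
  -- of the negated eigenvalues has a single negative factor.
  by_cases h0 : ∃ i, hA.eigenvalues i = 0
  · obtain ⟨i, hi⟩ := h0
    rw [hdet, Finset.prod_eq_zero (Finset.mem_univ i) hi, mul_zero]
  push Not at h0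
  obtain ⟨i, hi⟩ : ∃ i, 0 < hA.eigenvalues i := by
    by_contra! hneg
    have := Finset.sum_neg (s := Finset.univ) (f := hA.eigenvalues)
      (fun i _ => lt_of_le_of_ne (hneg i) (h0 i)) Finset.univ_nonempty
    linarith
  have hother : ∀ j ≠ i, hA.eigenvalues j < 0 := fun j hj => by
    refine lt_of_le_of_ne (not_lt.1 fun hpos => hj ?_) (h0 j)
    exact Finset.card_le_one.1 h _ (by simpa using hpos) _ (by simpa using hi)
  have : (-1 : ℝ) ^ Fintype.card I * A.det = ∏ j, -hA.eigenvalues j := by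
    rw [hdet, Finset.prod_neg]; rfl
  rw [this, ← Finset.mul_prod_erase _ _ (Finset.mem_univ i)]
  refine mul_nonpos_of_nonpos_of_nonneg (by linarith) (Finset.prod_nonneg fun j hj => ?_)
  linarith [hother j (Finset.ne_of_mem_erase hj)]

end KissingSpheres

/-! ### Determinant condition, eigenvalue condition and Lorentzian Gram vectors -/

namespace KissingSpheres

variable {I : Type*} [Fintype I] [DecidableEq I]

theorem rank_eq_card_pos_add_card_neg {A : Matrix I I ℝ} (hA : A.IsHermitian) :
    A.rank = (Finset.univ.filter fun i => 0 < hA.eigenvalues i).card +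
      (Finset.univ.filter fun i => hA.eigenvalues i < 0).card := by
  rw [hA.rank_eq_card_non_zero_eigs, Fintype.card_subtype, ← Finset.card_union_of_disjoint]
  · congr 1
    ext i
    simp only [Finset.mem_filter, Finset.mem_univ, true_and, Finset.mem_union]
    exact ne_iff_lt_or_gt.trans or_comm
  · rw [Finset.disjoint_filter]
    intro i _ h1 h2
    exact lt_asymm h1 h2

theorem trace_distMatrix {J : Type*} [Fintype J] {d : J → J → ℝ} (hself : ∀ i, d i i = 0) :
    (distMatrix d).trace = 0 := by
  simp [Matrix.trace, distMatrix, hself]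

theorem determinantCondition_of_nonposOnHyperplane {n : ℕ} {d : I → I → ℝ}
    (hsymm : ∀ i j, d i j = d j i) (hself : ∀ i, d i i = 0)
    (h : NonposOnHyperplane (distMatrix d)) (hrank : (distMatrix d).rank ≤ n + 1) :
    DeterminantCondition d n := by
  refine ⟨fun J hJ => ?_, hrank⟩
  have : Nonempty J := hJ.to_subtype
  have hH := distMatrix_isHermitian (fun i j : J => d i j) fun i j => hsymm i j
  have := neg_one_pow_card_mul_det_nonpos hH (trace_distMatrix fun i => hself i)
    (card_pos_eigenvalues_le_one hH (h.submatrix J))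
  rwa [Fintype.card_coe] at this

theorem determinantCondition_of_eigenvalueCondition {n : ℕ} {d : I → I → ℝ}
    (hsymm : ∀ i j, d i j = d j i) (hself : ∀ i, d i i = 0)
    (h : EigenvalueCondition d hsymm n) : DeterminantCondition d n := by
  refine determinantCondition_of_nonposOnHyperplane hsymm hself
    (nonposOnHyperplane_of_card_eq_one _ h.1) ?_
  rw [rank_eq_card_pos_add_card_neg (distMatrix_isHermitian d hsymm)]
  have h1 := h.1
  have h2 := h.2
  omega

theorem eigenvalueCondition_of_determinantCondition {n : ℕ} {d : I → I → ℝ}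
    (hsymm : ∀ i j, d i j = d j i) (hself : ∀ i, d i i = 0) (hne : ∃ i j, d i j ≠ 0)
    (h : DeterminantCondition d n) : EigenvalueCondition d hsymm n := by
  have hH := distMatrix_isHermitian d hsymm
  have h1 := card_pos_eigenvalues_le_one_of_minors hH h.1
  -- If no eigenvalue were positive, trace zero would make them all vanish, and with them the
  -- matrix.
  have hpos : 0 < (Finset.univ.filter fun i => 0 < hH.eigenvalues i).card := by
    rw [Finset.card_pos]
    by_contra hemp
    rw [Finset.not_nonempty_iff_eq_empty, Finset.filter_eq_empty_iff] at hemp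
    have hsum : ∑ i, hH.eigenvalues i = 0 := by
      rw [← trace_distMatrix hself]; simpa using hH.trace_eq_sum_eigenvalues.symm
    have hz := (Finset.sum_eq_zero_iff_of_nonpos
      fun i hi => not_lt.1 (hemp hi)).1 hsum
    obtain ⟨i, j, hij⟩ := hne
    have := apply_eq_sum_eigenvalues hH i j
    rw [Finset.sum_eq_zero fun k hk => by rw [hz k hk, zero_mul]] at this
    exact hij (pow_eq_zero_iff (two_ne_zero)|>.1 this)
  have hr := h.2
  rw [rank_eq_card_pos_add_card_neg hH] at hr
  exact ⟨by omega, by omega⟩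

/-- A matrix with one positive and at most `n` negative eigenvalues is a Gram matrix of vectors in
Lorentzian space of signature `(1, n)`. -/
theorem exists_lorentzian_gram {n : ℕ} {A : Matrix I I ℝ} (hA : A.IsHermitian)
    (hpos : (Finset.univ.filter fun i => 0 < hA.eigenvalues i).card = 1)
    (hneg : (Finset.univ.filter fun i => hA.eigenvalues i < 0).card ≤ n) :
    ∃ (a : I → ℝ) (z : I → E n), ∀ i j, A i j = 2 * (a i * a j - ⟪z i, z j⟫) := by
  obtain ⟨k₀, hk₀⟩ := Finset.card_eq_one.1 hpos
  set N := Finset.univ.filter fun i => hA.eigenvalues i < 0 with hN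
  have hk₀pos : 0 < hA.eigenvalues k₀ := by
    have : k₀ ∈ Finset.univ.filter fun i => 0 < hA.eigenvalues i := by simp [hk₀]
    simpa using this
  obtain ⟨e⟩ : Nonempty (N ↪ Fin n) :=
    Function.Embedding.nonempty_of_card_le (by simpa using hneg)
  -- Scaled eigenvectors serve as coordinates: the positive one as time, the negative ones as
  -- distinct space axes chosen by `e`. Halving offsets the factor 2 in the product.
  refine ⟨fun i => √(hA.eigenvalues k₀ / 2) * hA.eigenvectorBasis k₀ i,
    fun i => ∑ k : N, (√(-hA.eigenvalues k / 2) * hA.eigenvectorBasis k i) •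
      EuclideanSpace.single (e k) (1 : ℝ), fun i j => ?_⟩
  have hinner : ∀ f g : N → ℝ, ⟪∑ k : N, f k • EuclideanSpace.single (e k) (1 : ℝ),
      ∑ k : N, g k • EuclideanSpace.single (e k) (1 : ℝ)⟫ = ∑ k, f k * g k := by
    intro f g
    have ho : Orthonormal ℝ fun k : N => EuclideanSpace.single (e k) (1 : ℝ) :=
      (EuclideanSpace.orthonormal_single).comp e e.injective
    simpa using ho.inner_sum f g Finset.univ
  have hs : ∀ i j, A i j = hA.eigenvalues k₀ * (hA.eigenvectorBasis k₀ i * hA.eigenvectorBasis k₀ j)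
      + ∑ k : N, hA.eigenvalues k * (hA.eigenvectorBasis k i * hA.eigenvectorBasis k j) := by
    intro i j
    rw [apply_eq_sum_eigenvalues hA, ← Finset.add_sum_erase _ _ (Finset.mem_univ k₀),
      Finset.sum_coe_sort N fun k => hA.eigenvalues k *
        (hA.eigenvectorBasis k i * hA.eigenvectorBasis k j)]
    congr 1
    symm
    refine Finset.sum_subset (fun k hk => ?_) fun k hk hkN => ?_
    · refine Finset.mem_erase.2 ⟨fun h => ?_, Finset.mem_univ _⟩
      subst h
      have := (Finset.mem_filter.1 hk).2
      linarith
    · have h1 : k ∉ Finset.univ.filter fun i => 0 < hA.eigenvalues i := by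
        rw [hk₀, Finset.mem_singleton]; exact Finset.ne_of_mem_erase hk
      simp only [Finset.mem_filter, Finset.mem_univ, true_and, not_lt, hN] at h1 hkN
      rw [le_antisymm h1 hkN, zero_mul]
  rw [hs, hinner, mul_sub, Finset.mul_sum, sub_eq_add_neg, ← Finset.sum_neg_distrib]
  congr 1
  · have := Real.mul_self_sqrt (by positivity : 0 ≤ hA.eigenvalues k₀ / 2)
    linear_combination (-2 * (hA.eigenvectorBasis k₀ i * hA.eigenvectorBasis k₀ j)) * this
  · refine Finset.sum_congr rfl fun k _ => ?_
    have hk := (Finset.mem_filter.1 k.2).2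
    have := Real.mul_self_sqrt (by linarith : 0 ≤ -hA.eigenvalues k / 2)
    linear_combination (2 * (hA.eigenvectorBasis k i * hA.eigenvectorBasis k j)) * this

/-- Isotropic vectors of a Lorentzian space with nonnegative products, none of which is orthogonal
to all of the others, may be chosen in the future light cone. -/
theorem exists_future_gram {J V : Type*} [NormedAddCommGroup V] [InnerProductSpace ℝ V]
    {A : J → J → ℝ} (hnonneg : ∀ i j, 0 ≤ A i j) (hself : ∀ i, A i i = 0)
    (hne : ∀ i, ∃ j, A i j ≠ 0) {a : J → ℝ} {z : J → V}
    (h : ∀ i j, A i j = 2 * (a i * a j - ⟪z i, z j⟫)) :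
    ∃ (a : J → ℝ) (z : J → V), (∀ i, 0 < a i) ∧
      ∀ i j, A i j = 2 * (a i * a j - ⟪z i, z j⟫) := by
  have hz : ∀ i, ⟪z i, z i⟫ = a i ^ 2 := fun i => by
    have := h i i
    rw [hself] at this
    linarith
  have ha0 : ∀ i, a i ≠ 0 := fun i hi => by
    have hzi : z i = 0 := by rw [← inner_self_eq_zero (𝕜 := ℝ), hz, hi]; simp
    obtain ⟨j, hj⟩ := hne i
    exact hj (by rw [h, hi, hzi]; simp)
  -- For opposite signs, nonnegativity of the product forces equality in Cauchy–Schwarz, so vector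
  -- `j` is a negative multiple of vector `i`. A positive entry of row `i` then yields a negative
  -- one in row `j`.
  have hsign : ∀ i j, 0 < a i → ¬ a j < 0 := by
    intro i j hi hj
    have hle : a i * a j - ⟪z i, z j⟫ ≥ 0 := by linarith [h i j, hnonneg i j]
    have hpar : z j = (a j / a i) • z i := by
      rw [← sub_eq_zero, ← real_inner_self_nonpos]
      simp only [inner_sub_left, inner_sub_right, inner_smul_left, inner_smul_right, hz,
        real_inner_comm (z i) (z j)]
      simp only [conj_trivial]
      have e1 : a j / a i * (a j / a i * a i ^ 2) = a j ^ 2 := by field_simp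
      have e2 : a j / a i * ⟪z i, z j⟫ ≥ a j ^ 2 := by
        have : a j / a i * (a i * a j) = a j ^ 2 := by field_simp
        have h3 : a j / a i ≤ 0 := (div_neg_of_neg_of_pos hj hi).le
        nlinarith
      linarith
    obtain ⟨k, hk⟩ := hne i
    have h1 : A j k = (a j / a i) * A i k := by
      rw [h, h, hpar, inner_smul_left]
      simp only [conj_trivial]
      field_simp
    have h2 : 0 < A i k := lt_of_le_of_ne (hnonneg i k) hk.symm
    have := mul_neg_of_neg_of_pos (div_neg_of_neg_of_pos hj hi) h2
    linarith [hnonneg j k]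
  by_cases hex : ∃ i, 0 < a i
  · obtain ⟨i, hi⟩ := hex
    exact ⟨a, z, fun j => lt_of_le_of_ne (not_lt.1 (hsign i j hi)) (ha0 j).symm, h⟩
  · push Not at hex
    exact ⟨fun i => -a i, fun i => -z i,
      fun i => neg_pos.2 (lt_of_le_of_ne (hex i) (ha0 i)), fun i j => by rw [h]; simp⟩

end KissingSpheres

/-! ### Möbius transformations as Lorentzian isometries -/

namespace KissingSpheres

/-- A vector of the Lorentzian space attached to the extended Euclidean space; it stands for the
function `a * ‖x‖ ^ 2 + b - 2 * ⟪w, x⟫`. -/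
@[ext]
structure InversiveVec (n : ℕ) where
  a : ℝ
  b : ℝ
  w : E n

namespace InversiveVec

variable {n : ℕ}

/-- The Lorentzian form. -/
noncomputable def form (s t : InversiveVec n) : ℝ := s.a * t.b + s.b * t.a - 2 * ⟪s.w, t.w⟫

theorem form_comm (v u : InversiveVec n) : v.form u = u.form v := by
  simp only [form, real_inner_comm v.w u.w]
  ring

/-- The value at a point of the extended space, for a fixed choice of homogeneous coordinates of
the point. -/
noncomputable def eval (s : InversiveVec n) : EHat n → ℝ
  | OnePoint.infty => s.a
  | OnePoint.some x => s.a * ⟪x, x⟫ + s.b - 2 * ⟪s.w, x⟫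

@[simp] theorem eval_infty (s : InversiveVec n) : s.eval OnePoint.infty = s.a := rfl

@[simp] theorem eval_coe (s : InversiveVec n) (x : E n) :
    s.eval x = s.a * ⟪x, x⟫ + s.b - 2 * ⟪s.w, x⟫ := rfl

/-- The Lorentzian reflection that lifts the inversion in a sphere. -/
noncomputable def inversion (c : E n) (r : ℝ) (s : InversiveVec n) : InversiveVec n where
  a := s.eval c / r ^ 2
  b := s.b + (s.eval c / r ^ 2 - s.a) * (⟪c, c⟫ - r ^ 2)
  w := s.w + (s.eval c / r ^ 2 - s.a) • c

/-- The Lorentzian reflection that lifts the reflection in a hyperplane. -/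
noncomputable def reflection (u : E n) (b : ℝ) (s : InversiveVec n) : InversiveVec n where
  a := s.a
  b := s.b + 4 * s.a * b ^ 2 - 4 * b * ⟪s.w, u⟫
  w := s.w + (2 * s.a * b - 2 * ⟪s.w, u⟫) • u

theorem inversion_involutive (c : E n) {r : ℝ} (hr : r ≠ 0) :
    Function.Involutive (inversion c r) := by
  intro s
  have ha : (inversion c r (inversion c r s)).a = s.a := by
    simp only [inversion, eval_coe, inner_add_left, inner_smul_left, conj_trivial]
    field_simp
    ring
  have hc : (inversion c r s).eval c / r ^ 2 = s.a := ha
  ext1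
  · exact ha
  · change (inversion c r s).b + ((inversion c r s).eval c / r ^ 2 - (inversion c r s).a) *
      (⟪c, c⟫ - r ^ 2) = s.b
    rw [hc]
    simp only [inversion]
    ring
  · change (inversion c r s).w + ((inversion c r s).eval c / r ^ 2 - (inversion c r s).a) • c = s.w
    rw [hc]
    simp only [inversion]
    module

theorem reflection_involutive {u : E n} (b : ℝ) (hu : ‖u‖ = 1) :
    Function.Involutive (reflection u b) := by
  intro s
  have h : ⟪u, u⟫ = (1 : ℝ) := by simp [hu]
  ext1
  · rfl
  · simp only [reflection, inner_add_left, inner_smul_left, conj_trivial, h]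
    ring
  · simp only [reflection, inner_add_left, inner_smul_left, conj_trivial, h]
    module

theorem form_inversion (c : E n) {r : ℝ} (hr : r ≠ 0) (s t : InversiveVec n) :
    (inversion c r s).form (inversion c r t) = s.form t := by
  obtain ⟨k, hk⟩ : ∃ k, s.eval c = k * r ^ 2 := ⟨s.eval c / r ^ 2, by field_simp⟩
  obtain ⟨l, hl⟩ : ∃ l, t.eval c = l * r ^ 2 := ⟨t.eval c / r ^ 2, by field_simp⟩
  have hr2 : r ^ 2 ≠ 0 := pow_ne_zero 2 hr
  simp only [form, inversion, hk, hl, mul_div_cancel_right₀ _ hr2, inner_add_left,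
    inner_add_right, inner_smul_left, inner_smul_right, conj_trivial]
  rw [eval_coe] at hk hl
  rw [real_inner_comm t.w c]
  linear_combination (l - t.a) * hk + (k - s.a) * hl

theorem form_reflection {u : E n} (b : ℝ) (hu : ‖u‖ = 1) (s t : InversiveVec n) :
    (reflection u b s).form (reflection u b t) = s.form t := by
  have h : ⟪u, u⟫ = (1 : ℝ) := by simp [hu]
  simp only [form, reflection, inner_add_left, inner_add_right, inner_smul_left,
    inner_smul_right, conj_trivial, h, real_inner_comm t.w u]
  ring

/-- The factor compares the chosen homogeneous coordinates of a point and of its image, so it is the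
same for all `s`. Its positivity preserves the sides of spheres, not only their zero sets. -/
theorem exists_eval_inversion (c : E n) {r : ℝ} (hr : r ≠ 0) (y : EHat n) :
    ∃ k > 0, ∀ s : InversiveVec n,
      (inversion c r s).eval y = k * s.eval (inversionFun c r y) := by
  induction y using OnePoint.rec with
  | infty =>
    refine ⟨(r ^ 2)⁻¹, by positivity, fun s => ?_⟩
    simp only [inversionFun, inversion, eval_infty]
    ring
  | coe x =>
    by_cases h : x = c
    · refine ⟨r ^ 2, by positivity, fun s => ?_⟩
      simp only [inversionFun, h, if_true, inversion, eval_infty, eval_coe, inner_add_left,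
        inner_smul_left, conj_trivial]
      field_simp
      ring
    · have hx : x - c ≠ 0 := sub_ne_zero.2 h
      have hpos : 0 < ⟪x - c, x - c⟫ := real_inner_self_pos.2 hx
      refine ⟨⟪x - c, x - c⟫ / r ^ 2, by positivity, fun s => ?_⟩
      obtain ⟨u, rfl⟩ : ∃ u, x = c + u := ⟨x - c, by abel⟩
      have hd : (r / dist (c + u) c) ^ 2 = r ^ 2 / ⟪u, u⟫ := by
        rw [dist_eq_norm, add_sub_cancel_left, div_pow, real_inner_self_eq_norm_sq]
      simp only [inversionFun, h, if_false, EuclideanGeometry.inversion, hd, vsub_eq_sub,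
        vadd_eq_add, add_sub_cancel_left] at hpos ⊢
      simp only [inversion, eval_coe, inner_add_left, inner_add_right, inner_smul_left,
        inner_smul_right, conj_trivial, real_inner_comm c u]
      field_simp
      ring

theorem eval_reflection {u : E n} (b : ℝ) (hu : ‖u‖ = 1) (y : EHat n) (s : InversiveVec n) :
    (reflection u b s).eval y = s.eval (reflectionFun u b y) := by
  have h : ⟪u, u⟫ = (1 : ℝ) := by simp [hu]
  induction y using OnePoint.rec with
  | infty => rfl
  | coe x =>
    simp only [reflectionFun, reflection, eval_coe, inner_add_left, inner_smul_left,
      conj_trivial, inner_sub_left, inner_sub_right, inner_smul_right, h, real_inner_comm u x]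
    ring

end InversiveVec

open InversiveVec

/-- A Lorentzian isometry that induces the given permutation of the extended space. -/
def IsLift {n : ℕ} (T : Equiv.Perm (EHat n)) (R : Equiv.Perm (InversiveVec n)) : Prop :=
  (∀ s t, (R s).form (R t) = s.form t) ∧ ∀ y, ∃ k > 0, ∀ s, (R s).eval (T y) = k * s.eval y

theorem isLift_sphereInversion {n : ℕ} (c : E n) (r : ℝ) (hr : r ≠ 0) :
    IsLift (sphereInversion c r hr) (inversion_involutive c hr).toPerm := by
  refine ⟨form_inversion c hr, fun y => ?_⟩
  obtain ⟨k, hk, h⟩ := exists_eval_inversion c hr (inversionFun c r y)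
  refine ⟨k, hk, fun s => ?_⟩
  rw [inversionFun_involutive c r hr y] at h
  exact h s

theorem isLift_hyperplaneReflection {n : ℕ} (a : E n) (b : ℝ) (ha : ‖a‖ = 1) :
    IsLift (hyperplaneReflection a b ha) (reflection_involutive b ha).toPerm := by
  refine ⟨form_reflection b ha, fun y => ⟨1, one_pos, fun s => ?_⟩⟩
  have := eval_reflection b ha (reflectionFun a b y) s
  rw [reflectionFun_involutive a b ha y] at this
  rw [one_mul]
  exact this

/-- Every Möbius transformation lifts to a Lorentzian isometry. -/
theorem exists_isLift {n : ℕ} {T : Equiv.Perm (EHat n)} (hT : T ∈ moebiusGroup n) :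
    ∃ R, IsLift T R := by
  induction hT using Subgroup.closure_induction with
  | mem T hT =>
    rcases hT with ⟨c, r, hr, rfl⟩ | ⟨a, b, ha, rfl⟩
    · exact ⟨_, isLift_sphereInversion c r hr⟩
    · exact ⟨_, isLift_hyperplaneReflection a b ha⟩
  | one => exact ⟨1, fun _ _ => rfl, fun y => ⟨1, one_pos, fun s => (one_mul _).symm⟩⟩
  | mul T T' _ _ ih ih' =>
    obtain ⟨R, hR, h⟩ := ih
    obtain ⟨R', hR', h'⟩ := ih'
    refine ⟨R * R', fun s t => ?_, fun y => ?_⟩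
    · simp only [Equiv.Perm.mul_apply, hR, hR']
    · obtain ⟨k', hk', e'⟩ := h' y
      obtain ⟨k, hk, e⟩ := h (T' y)
      exact ⟨k * k', mul_pos hk hk', fun s => by
        simp only [Equiv.Perm.mul_apply, e, e', mul_assoc]⟩
  | inv T _ ih =>
    obtain ⟨R, hR, h⟩ := ih
    refine ⟨R⁻¹, fun s t => ?_, fun y => ?_⟩
    · rw [← hR]; simp
    · obtain ⟨k, hk, e⟩ := h (T⁻¹ y)
      refine ⟨k⁻¹, inv_pos.2 hk, fun s => ?_⟩
      have := e (R⁻¹ s)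
      rw [show R (R⁻¹ s) = s from R.apply_symm_apply s,
        show T (T⁻¹ y) = y from T.apply_symm_apply y] at this
      rw [this]
      field_simp

theorem IsLift.image_eval_eq_zero {n : ℕ} {T : Equiv.Perm (EHat n)}
    {R : Equiv.Perm (InversiveVec n)} (h : IsLift T R) (s : InversiveVec n) :
    T '' {y | s.eval y = 0} = {y | (R s).eval y = 0} := by
  ext y
  rw [Equiv.image_eq_preimage_symm, Set.mem_preimage, Set.mem_ofPred_eq, Set.mem_ofPred_eq]
  obtain ⟨k, hk, e⟩ := h.2 (T.symm y)
  have := e s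
  rw [Equiv.apply_symm_apply] at this
  rw [this, mul_eq_zero, or_iff_right hk.ne']

theorem IsLift.image_eval_nonpos {n : ℕ} {T : Equiv.Perm (EHat n)}
    {R : Equiv.Perm (InversiveVec n)} (h : IsLift T R) (s : InversiveVec n) :
    T '' {y | s.eval y ≤ 0} = {y | (R s).eval y ≤ 0} := by
  ext y
  rw [Equiv.image_eq_preimage_symm, Set.mem_preimage, Set.mem_ofPred_eq, Set.mem_ofPred_eq]
  obtain ⟨k, hk, e⟩ := h.2 (T.symm y)
  have := e s
  rw [Equiv.apply_symm_apply] at this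
  rw [this]
  constructor
  · exact fun h => mul_nonpos_of_nonneg_of_nonpos hk.le h
  · exact fun h => nonpos_of_mul_nonpos_right h hk

end KissingSpheres

/-! ### Kissing spheres as light-like vectors -/

namespace KissingSpheres

open InversiveVec

theorem coe_mem_roundSphere {n : ℕ} {c x : E n} {φ : ℝ} :
    (x : EHat n) ∈ roundSphere c φ ↔ dist x c = φ / 2 := by
  simp [roundSphere]

theorem infty_notMem_roundSphere {n : ℕ} {c : E n} {φ : ℝ} : OnePoint.infty ∉ roundSphere c φ := by
  simp [roundSphere]

theorem coe_mem_hyperplane {n : ℕ} {a x : E n} {b : ℝ} :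
    (x : EHat n) ∈ hyperplane a b ↔ ⟪a, x⟫ = b := by
  simp [hyperplane]

variable {n : ℕ} [NeZero n]

/-- The unit normal of the boundary hyperplane. -/
noncomputable abbrev e₀ (n : ℕ) [NeZero n] : E n := EuclideanSpace.single 0 1

theorem inner_e₀_left (x : E n) : ⟪e₀ n, x⟫ = x 0 := by
  rw [e₀, EuclideanSpace.inner_single_left]
  simp

theorem inner_e₀_right (x : E n) : ⟪x, e₀ n⟫ = x 0 := by
  rw [real_inner_comm, inner_e₀_left]

/-- The vector of the half-space `x 0 ≤ 0`. -/
noncomputable def halfVec (n : ℕ) [NeZero n] : InversiveVec n := ⟨0, 0, -(1 / 2 : ℝ) • e₀ n⟩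

/-- The vector whose zero set is the kissing sphere with light-like vector `v`. -/
noncomputable def kissVec (v : InversiveVec n) : InversiveVec n :=
  ⟨v.a, v.b, v.w + (1 / 2 : ℝ) • e₀ n⟩

theorem eval_halfVec_coe (x : E n) : (halfVec n).eval x = x 0 := by
  simp only [halfVec, eval_coe, inner_smul_left, inner_e₀_left, conj_trivial]
  ring

theorem eval_kissVec_coe (v : InversiveVec n) (x : E n) :
    (kissVec v).eval x = v.eval x - x 0 := by
  simp only [kissVec, eval_coe, inner_add_left, inner_smul_left, inner_e₀_left, conj_trivial]
  ring

/-- `kissVec v` is `v` minus `halfVec n`, which is orthogonal to `v` and `u` and has square -1/2. -/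
theorem form_kissVec {v u : InversiveVec n} (hv : v.w 0 = 0) (hu : u.w 0 = 0) :
    (kissVec v).form (kissVec u) = v.form u - 1 / 2 := by
  simp only [kissVec, form, inner_add_left, inner_add_right, inner_smul_left, inner_smul_right,
    inner_e₀_left, inner_e₀_right, conj_trivial, hv, hu]
  simp
  ring

theorem form_kissVec_halfVec {v : InversiveVec n} (hv : v.w 0 = 0) :
    (kissVec v).form (halfVec n) = 1 / 2 := by
  simp only [kissVec, halfVec, form, inner_add_left, inner_smul_left, inner_smul_right,
    inner_e₀_right, conj_trivial, hv]
  simp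

/-- The future light cone in the space of vectors orthogonal to `halfVec`. -/
structure IsLight (v : InversiveVec n) : Prop where
  w_zero : v.w 0 = 0
  a_nonneg : 0 ≤ v.a
  b_nonneg : 0 ≤ v.b
  a_mul_b : v.a * v.b = ⟪v.w, v.w⟫
  ne_zero : v.a ≠ 0 ∨ v.b ≠ 0

theorem IsLight.form_self {v : InversiveVec n} (hv : IsLight v) : v.form v = 0 := by
  simp only [form]
  linarith [hv.a_mul_b]

theorem IsLight.w_eq_zero {v : InversiveVec n} (hv : IsLight v) (ha : v.a = 0) : v.w = 0 := by
  rw [← inner_self_eq_zero (𝕜 := ℝ), ← hv.a_mul_b, ha, zero_mul]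

theorem IsLight.eval_of_a_eq_zero {v : InversiveVec n} (hv : IsLight v) (ha : v.a = 0) (x : E n) :
    v.eval x = v.b := by
  simp [ha, hv.w_eq_zero ha]

theorem IsLight.b_pos {v : InversiveVec n} (hv : IsLight v) (ha : v.a = 0) : 0 < v.b :=
  lt_of_le_of_ne hv.b_nonneg (hv.ne_zero.resolve_left (not_not.2 ha)).symm

theorem IsLight.a_pos {v : InversiveVec n} (hv : IsLight v) (ha : v.a ≠ 0) : 0 < v.a :=
  lt_of_le_of_ne hv.a_nonneg ha.symm

/-- Completing the square leaves no constant, because `v` is isotropic. -/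
theorem IsLight.eval_of_a_ne_zero {v : InversiveVec n} (hv : IsLight v) (ha : v.a ≠ 0) (x : E n) :
    v.eval x = v.a * ⟪x - v.a⁻¹ • v.w, x - v.a⁻¹ • v.w⟫ := by
  have h := hv.a_mul_b
  simp only [eval_coe, inner_sub_left, inner_sub_right, inner_smul_left, inner_smul_right,
    conj_trivial, ← h, real_inner_comm v.w x]
  field_simp
  ring

theorem IsLight.eval_nonneg {v : InversiveVec n} (hv : IsLight v) (x : E n) : 0 ≤ v.eval x := by
  by_cases ha : v.a = 0
  · rw [hv.eval_of_a_eq_zero ha]; exact hv.b_nonneg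
  · rw [hv.eval_of_a_ne_zero ha]
    exact mul_nonneg hv.a_nonneg real_inner_self_nonneg

/-- The tangent point of the kissing sphere with light-like vector `v`. -/
noncomputable def lightPoint (v : InversiveVec n) : EHat n :=
  open Classical in if v.a = 0 then OnePoint.infty else ↑(v.a⁻¹ • v.w)

theorem mem_boundary_infty : OnePoint.infty ∈ boundary n := Or.inl rfl

theorem coe_mem_boundary {x : E n} : (x : EHat n) ∈ boundary n ↔ x 0 = 0 := by
  simp [boundary]

theorem coe_mem_upperHalfSpace {x : E n} : (x : EHat n) ∈ upperHalfSpace n ↔ 0 ≤ x 0 := by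
  simp [upperHalfSpace]

theorem lowerHalfSpace_eq : lowerHalfSpace n = {y | (halfVec n).eval y ≤ 0} := by
  ext y
  induction y using OnePoint.rec with
  | infty => simp [lowerHalfSpace, halfVec]
  | coe x =>
    rw [Set.mem_ofPred_eq, eval_halfVec_coe]
    simp [lowerHalfSpace]

/-- On the boundary `kissVec v` takes the same values as `v`, whose only zero is the light point. -/
theorem IsLight.inter_boundary {v : InversiveVec n} (hv : IsLight v) :
    {y | (kissVec v).eval y = 0} ∩ boundary n = {lightPoint v} := by
  ext y
  rw [Set.mem_inter_iff, Set.mem_ofPred_eq, Set.mem_singleton_iff, lightPoint]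
  induction y using OnePoint.rec with
  | infty =>
    by_cases ha : v.a = 0 <;> simp [kissVec, ha, mem_boundary_infty]
  | coe x =>
    rw [coe_mem_boundary, eval_kissVec_coe]
    by_cases ha : v.a = 0
    · rw [if_pos ha, hv.eval_of_a_eq_zero ha]
      have := hv.b_pos ha
      simp only [OnePoint.coe_ne_infty, iff_false, not_and]
      intro h1 h2
      linarith
    · rw [if_neg ha, hv.eval_of_a_ne_zero ha, OnePoint.coe_eq_coe]
      constructor
      · rintro ⟨h1, h2⟩
        rw [h2, sub_zero, mul_eq_zero, or_iff_right ha, inner_self_eq_zero, sub_eq_zero] at h1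
        exact h1
      · rintro rfl
        simp [hv.w_zero]

theorem IsLight.subset_upperHalfSpace {v : InversiveVec n} (hv : IsLight v) :
    {y | (kissVec v).eval y = 0} ⊆ upperHalfSpace n := by
  intro y hy
  rw [Set.mem_ofPred_eq] at hy
  induction y using OnePoint.rec with
  | infty => exact Or.inl rfl
  | coe x =>
    rw [coe_mem_upperHalfSpace]
    rw [eval_kissVec_coe] at hy
    linarith [hv.eval_nonneg x]

theorem IsLight.eq_roundSphere {v : InversiveVec n} (hv : IsLight v) (ha : v.a ≠ 0) :
    {y | (kissVec v).eval y = 0} =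
      roundSphere (v.a⁻¹ • v.w + (v.a⁻¹ / 2) • e₀ n) v.a⁻¹ := by
  have hpos := hv.a_pos ha
  ext y
  rw [Set.mem_ofPred_eq]
  induction y using OnePoint.rec with
  | infty => simpa [infty_notMem_roundSphere, kissVec] using ha
  | coe x =>
    rw [coe_mem_roundSphere, eval_kissVec_coe, hv.eval_of_a_ne_zero ha, dist_eq_norm,
      ← sq_eq_sq₀ (norm_nonneg _) (by positivity), ← real_inner_self_eq_norm_sq, ← sub_sub]
    -- With the tangent point moved to the origin, the equation is `v.a * ⟪z, z⟫ = z 0`.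
    obtain ⟨z, hz⟩ : ∃ z, z = x - v.a⁻¹ • v.w := ⟨_, rfl⟩
    have hx0 : x 0 = z 0 := by rw [hz]; simp [hv.w_zero]
    rw [← hz, hx0, inner_sub_left, inner_sub_right, inner_sub_right, inner_smul_left,
      inner_smul_right, inner_smul_right, inner_smul_left, inner_e₀_left, inner_e₀_right,
      inner_e₀_left]
    simp only [conj_trivial, PiLp.single_apply, if_true]
    constructor
    · intro h
      have : v.a * ⟪z, z⟫ = z 0 := by linarith
      rw [← this]
      field_simp
      ring
    · intro h
      have : ⟪z, z⟫ = v.a⁻¹ * z 0 := by linarith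
      rw [this]
      field_simp
      ring

theorem IsLight.eq_hyperplane {v : InversiveVec n} (hv : IsLight v) (ha : v.a = 0) :
    {y | (kissVec v).eval y = 0} = hyperplane (e₀ n) v.b := by
  ext y
  rw [Set.mem_ofPred_eq]
  induction y using OnePoint.rec with
  | infty => simpa [hyperplane, kissVec] using ha
  | coe x =>
    rw [coe_mem_hyperplane, eval_kissVec_coe, hv.eval_of_a_eq_zero ha, inner_e₀_left, sub_eq_zero,
      eq_comm]

theorem norm_e₀ : ‖e₀ n‖ = 1 := by simp

/-- The kissing sphere with a given light-like vector. -/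
noncomputable def IsLight.kissingSphere {v : InversiveVec n} (hv : IsLight v) :
    KissingSphere n where
  carrier := {y | (kissVec v).eval y = 0}
  isSphere := by
    by_cases ha : v.a = 0
    · exact Or.inr ⟨e₀ n, v.b, norm_e₀, hv.eq_hyperplane ha⟩
    · exact Or.inl ⟨_, v.a⁻¹, inv_pos.2 (hv.a_pos ha), hv.eq_roundSphere ha⟩
  subset_upper := hv.subset_upperHalfSpace
  tangent := ⟨_, hv.inter_boundary⟩

/-- The kissing sphere `p` has the light-like vector `v`. -/
def HasLightVec (p : KissingSphere n) (v : InversiveVec n) : Prop :=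
  IsLight v ∧ p.carrier = {y | (kissVec v).eval y = 0}

theorem HasLightVec.tangentPoint_eq {p : KissingSphere n} {v : InversiveVec n}
    (h : HasLightVec p v) : p.tangentPoint = lightPoint v := by
  have h1 : p.carrier ∩ boundary n = {p.tangentPoint} := p.tangent.choose_spec
  rw [h.2, h.1.inter_boundary, Set.singleton_eq_singleton_iff] at h1
  exact h1.symm

theorem ediam_roundSphere (c : E n) {φ : ℝ} (hφ : 0 ≤ φ) :
    Metric.ediam {x : E n | (x : EHat n) ∈ roundSphere c φ} = ENNReal.ofReal φ := by
  simp only [coe_mem_roundSphere]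
  apply le_antisymm
  · refine Metric.ediam_le fun x hx y hy => ?_
    rw [edist_dist]
    refine ENNReal.ofReal_le_ofReal ?_
    rw [Set.mem_ofPred_eq] at hx hy
    linarith [dist_triangle_right x y c]
  · have hmem : ∀ k : ℝ, |k| = φ / 2 → c + k • e₀ n ∈ {x : E n | dist x c = φ / 2} := by
      intro k hk
      rw [Set.mem_ofPred_eq, dist_eq_norm, add_sub_cancel_left, norm_smul, norm_e₀, mul_one,
        Real.norm_eq_abs, hk]
    have h1 := hmem (φ / 2) (abs_of_nonneg (by positivity))
    have h2 := hmem (-(φ / 2)) (by rw [abs_neg]; exact abs_of_nonneg (by positivity))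
    refine le_trans (le_of_eq ?_) (Metric.edist_le_ediam_of_mem h1 h2)
    rw [edist_dist, dist_eq_norm, add_sub_add_left_eq_sub, ← sub_smul, norm_smul, norm_e₀, mul_one,
      Real.norm_eq_abs]
    congr 1
    rw [abs_of_nonneg (by linarith)]
    ring

theorem HasLightVec.diameter_eq {p : KissingSphere n} {v : InversiveVec n}
    (h : HasLightVec p v) (ha : v.a ≠ 0) : p.diameter = ENNReal.ofReal v.a⁻¹ := by
  rw [KissingSphere.diameter, h.2, h.1.eq_roundSphere ha,
    ediam_roundSphere _ (inv_nonneg.2 h.1.a_nonneg)]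

theorem exists_light_of_roundSphere {c : E n} {φ : ℝ} (hφ : 0 < φ)
    (hsub : roundSphere c φ ⊆ upperHalfSpace n)
    (ht : ∃ t, roundSphere c φ ∩ boundary n = {t}) :
    ∃ v : InversiveVec n, IsLight v ∧ roundSphere c φ = {y | (kissVec v).eval y = 0} := by
  -- A common point with the boundary bounds the height of the centre above; the lowest point of the
  -- sphere bounds it below.
  have hc : c 0 = φ / 2 := by
    apply le_antisymm
    · obtain ⟨t, ht⟩ := ht
      have htm : t ∈ roundSphere c φ ∩ boundary n := by rw [ht]; rfl
      induction t using OnePoint.rec with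
      | infty => exact absurd htm.1 infty_notMem_roundSphere
      | coe x =>
        have h1 := coe_mem_roundSphere.1 htm.1
        have h2 := coe_mem_boundary.1 htm.2
        have h3 : |x 0 - c 0| ≤ ‖x - c‖ := by
          simpa using PiLp.norm_apply_le (x - c) 0
        rw [dist_eq_norm] at h1
        rw [h1, h2, zero_sub, abs_neg] at h3
        exact (le_abs_self _).trans h3
    · have hmem : ((c - (φ / 2) • e₀ n : E n) : EHat n) ∈ roundSphere c φ := by
        rw [coe_mem_roundSphere, dist_eq_norm, sub_sub_cancel_left, norm_neg, norm_smul, norm_e₀,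
          mul_one, Real.norm_eq_abs, abs_of_pos (by positivity)]
      have := coe_mem_upperHalfSpace.1 (hsub hmem)
      simpa using this
  have hv : IsLight (⟨φ⁻¹, φ * ⟪φ⁻¹ • (c - (φ / 2) • e₀ n), φ⁻¹ • (c - (φ / 2) • e₀ n)⟫,
      φ⁻¹ • (c - (φ / 2) • e₀ n)⟩ : InversiveVec n) := by
    refine ⟨?_, by positivity, mul_nonneg hφ.le real_inner_self_nonneg, ?_, Or.inl (by positivity)⟩
    · simp [hc]
    · simp only
      rw [← mul_assoc, inv_mul_cancel₀ hφ.ne', one_mul]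
  refine ⟨_, hv, ?_⟩
  rw [hv.eq_roundSphere (by simpa using hφ.ne')]
  simp only [inv_inv]
  rw [smul_inv_smul₀ hφ.ne', sub_add_cancel]

theorem exists_light_of_hyperplane {a : E n} {b : ℝ} (ha : ‖a‖ = 1)
    (hsub : hyperplane a b ⊆ upperHalfSpace n)
    (ht : ∃ t, hyperplane a b ∩ boundary n = {t}) :
    ∃ v : InversiveVec n, IsLight v ∧ hyperplane a b = {y | (kissVec v).eval y = 0} := by
  have haa : ⟪a, a⟫ = (1 : ℝ) := by simp [ha]
  -- The height along a line in the hyperplane is affine in `k`; being nonnegative for all `k`, it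
  -- has slope zero, so the normal is ± `e₀ n`.
  have hmem : ∀ k : ℝ, 0 ≤ b * a 0 + k * (1 - a 0 * a 0) := by
    intro k
    have : ((b • a + k • (e₀ n - a 0 • a) : E n) : EHat n) ∈ hyperplane a b := by
      rw [coe_mem_hyperplane]
      simp only [inner_add_right, inner_sub_right, inner_smul_right, haa, inner_e₀_right]
      ring
    have := coe_mem_upperHalfSpace.1 (hsub this)
    simpa using this
  have hsq : a 0 * a 0 = 1 := by
    by_contra hne
    have hne' : 1 - a 0 * a 0 ≠ 0 := fun h => hne (by linarith)
    have := hmem ((-b * a 0 - 1) / (1 - a 0 * a 0))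
    rw [div_mul_cancel₀ _ hne'] at this
    linarith
  have hb0 : 0 ≤ b * a 0 := by simpa using hmem 0
  have hae : a = a 0 • e₀ n := by
    rw [← sub_eq_zero, ← inner_self_eq_zero (𝕜 := ℝ)]
    simp only [inner_sub_left, inner_sub_right, inner_smul_left, inner_smul_right, haa,
      inner_e₀_left, inner_e₀_right, conj_trivial]
    simp
    linarith
  have hiff : ∀ x : E n, ⟪a, x⟫ = b ↔ x 0 = b * a 0 := by
    intro x
    have : ⟪a, x⟫ = a 0 * x 0 := by
      conv_lhs => rw [hae]
      rw [inner_smul_left, inner_e₀_left, conj_trivial]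
    rw [this]
    constructor
    · intro h; linear_combination (-(x 0)) * hsq + a 0 * h
    · intro h; linear_combination b * hsq + a 0 * h
  -- Otherwise the hyperplane is the boundary itself, with more than one common point.
  have hbne : b * a 0 ≠ 0 := by
    intro h0
    obtain ⟨t, ht⟩ := ht
    have h1 : OnePoint.infty ∈ hyperplane a b ∩ boundary n := ⟨Or.inl rfl, Or.inl rfl⟩
    have h2 : ((0 : E n) : EHat n) ∈ hyperplane a b ∩ boundary n := by
      refine ⟨?_, ?_⟩
      · rw [coe_mem_hyperplane, hiff, h0]; simp
      · rw [coe_mem_boundary]; simp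
    rw [ht, Set.mem_singleton_iff] at h1 h2
    exact OnePoint.coe_ne_infty _ (h2.trans h1.symm)
  have hv : IsLight (⟨0, b * a 0, 0⟩ : InversiveVec n) :=
    ⟨by simp, le_rfl, hb0, by simp, Or.inr hbne⟩
  refine ⟨_, hv, ?_⟩
  rw [hv.eq_hyperplane rfl]
  ext y
  induction y using OnePoint.rec with
  | infty => simp [hyperplane]
  | coe x => rw [coe_mem_hyperplane, coe_mem_hyperplane, inner_e₀_left, hiff]

theorem exists_hasLightVec (p : KissingSphere n) : ∃ v, HasLightVec p v := by
  have hsub := p.subset_upper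
  have ht := p.tangent
  rcases p.isSphere with ⟨c, φ, hφ, h⟩ | ⟨a, b, ha, h⟩
  · rw [h] at hsub ht
    obtain ⟨v, hv, e⟩ := exists_light_of_roundSphere hφ hsub ht
    exact ⟨v, hv, h.trans e⟩
  · rw [h] at hsub ht
    obtain ⟨v, hv, e⟩ := exists_light_of_hyperplane ha hsub ht
    exact ⟨v, hv, h.trans e⟩

end KissingSpheres

/-! ### The distance as a Lorentzian product -/

namespace KissingSpheres

open InversiveVec

variable {n : ℕ} [NeZero n]

/-- The half-space determines its vector, in dimension at least two. -/
theorem eq_halfVec (hn : 2 ≤ n) {s : InversiveVec n}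
    (hs : {y | s.eval y ≤ 0} = lowerHalfSpace n)
    (hform : s.form s = (halfVec n).form (halfVec n)) : s = halfVec n := by
  have hiff : ∀ x : E n, s.eval x ≤ 0 ↔ x 0 ≤ 0 := by
    intro x
    have := Set.ext_iff.1 hs (x : EHat n)
    rwa [lowerHalfSpace_eq, Set.mem_ofPred_eq, Set.mem_ofPred_eq, eval_halfVec_coe] at this
  -- A boundary point is a limit of points with `0 < x 0`, where `s` is positive.
  have hzero : ∀ x : E n, x 0 = 0 → s.eval x = 0 := by
    intro x hx
    refine le_antisymm ((hiff x).2 hx.le) ?_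
    have hlim : Filter.Tendsto (fun k : ℝ => s.eval x + (s.a * k ^ 2 - 2 * s.w 0 * k))
        (nhdsWithin 0 (Set.Ioi 0)) (nhds (s.eval x)) := by
      have hc : Continuous fun k : ℝ => s.eval x + (s.a * k ^ 2 - 2 * s.w 0 * k) := by fun_prop
      simpa using (hc.tendsto 0).mono_left nhdsWithin_le_nhds
    refine ge_of_tendsto hlim (eventually_nhdsWithin_of_forall fun k hk => ?_)
    have hk' : ¬ (x + k • e₀ n) 0 ≤ 0 := by
      have : 0 < k := hk
      simpa [hx] using this
    rw [← hiff, not_le] at hk'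
    refine hk'.le.trans (le_of_eq ?_)
    simp only [eval_coe, inner_add_left, inner_add_right, inner_smul_left, inner_smul_right,
      inner_e₀_left, inner_e₀_right, conj_trivial, hx]
    simp
    ring
  have hb : s.b = 0 := by simpa using hzero 0 (by simp)
  -- Dimension at least two provides the unit vectors ± e₁ in the boundary; adding the two equations
  -- kills the linear term.
  have ha : s.a = 0 := by
    have h01 : (0 : Fin n) ≠ ⟨1, hn⟩ := by
      rw [Ne, Fin.ext_iff]; simp
    have h1 := hzero (EuclideanSpace.single ⟨1, hn⟩ 1) (by simp [h01])
    have h2 := hzero (-EuclideanSpace.single ⟨1, hn⟩ 1) (by simp [h01])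
    simp only [eval_coe, hb, inner_neg_right, inner_neg_left,
      EuclideanSpace.inner_single_right] at h1 h2
    simp at h1 h2
    linarith
  have hw : s.w = s.w 0 • e₀ n := by
    have := hzero (s.w - s.w 0 • e₀ n) (by simp)
    rw [← sub_eq_zero, ← inner_self_eq_zero (𝕜 := ℝ)]
    simp only [eval_coe, ha, hb, inner_sub_left, inner_sub_right, inner_smul_left,
      inner_smul_right, inner_e₀_left, inner_e₀_right, conj_trivial] at this ⊢
    simp at this ⊢
    linarith
  have hneg : s.w 0 < 0 := by
    have := (hiff (e₀ n)).not.2 (by simp)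
    simp only [eval_coe, ha, hb, inner_e₀_right] at this
    linarith
  have hw0 : s.w 0 = -(1 / 2) := by
    simp only [form, halfVec, ha, hb] at hform
    rw [hw] at hform
    simp only [inner_smul_left, inner_smul_right, inner_e₀_left, conj_trivial] at hform
    simp at hform
    nlinarith
  ext1
  · exact ha
  · exact hb
  · rw [hw, hw0]; rfl

/-- A kissing sphere of diameter one, normalized by the half-space, determines its vector. -/
theorem eq_kissVec {v s : InversiveVec n} (hv : IsLight v) (ha : v.a = 1)
    (hs : {y | s.eval y = 0} = {y | (kissVec v).eval y = 0})
    (hform : s.form (halfVec n) = 1 / 2) : s = kissVec v := by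
  set c := (kissVec v).w with hc
  have hc0 : c 0 = 1 / 2 := by simp [hc, kissVec, hv.w_zero]
  have hb : v.b = ⟪c, c⟫ - 1 / 4 := by
    have := hv.a_mul_b
    rw [ha, one_mul] at this
    simp only [hc, kissVec, inner_add_left, inner_add_right, inner_smul_left, inner_smul_right,
      inner_e₀_left, inner_e₀_right, conj_trivial, hv.w_zero, this]
    simp
    ring
  have hzero : ∀ u : E n, ⟪u, u⟫ = 1 / 4 →
      s.a * (⟪c, c⟫ + 2 * ⟪c, u⟫ + 1 / 4) + s.b - 2 * ⟪s.w, c⟫ - 2 * ⟪s.w, u⟫ = 0 := by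
    intro u hu
    have hmem : ((c + u : E n) : EHat n) ∈ {y | (kissVec v).eval y = 0} := by
      rw [Set.mem_ofPred_eq, eval_coe, ← hc]
      change v.a * _ + v.b - _ = 0
      simp only [ha, hb, inner_add_left, inner_add_right, hu, real_inner_comm c u]
      ring
    rw [← hs, Set.mem_ofPred_eq] at hmem
    simp only [eval_coe, inner_add_left, inner_add_right, hu, real_inner_comm c u] at hmem
    linarith
  -- Subtract the equations at the antipodal points `c + u` and `c - u`.
  have horth : ∀ u : E n, ⟪u, u⟫ = 1 / 4 → ⟪s.a • c - s.w, u⟫ = 0 := by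
    intro u hu
    have h1 := hzero u hu
    have h2 := hzero (-u) (by simpa using hu)
    simp only [inner_neg_right] at h2
    simp only [inner_sub_left, inner_smul_left, conj_trivial]
    linarith
  have hw : s.w = s.a • c := by
    by_contra hne
    have hne' : s.a • c - s.w ≠ 0 := sub_ne_zero.2 (Ne.symm hne)
    have hpos : ‖s.a • c - s.w‖ ≠ 0 := norm_ne_zero_iff.2 hne'
    have := horth ((1 / 2 * ‖s.a • c - s.w‖⁻¹) • (s.a • c - s.w)) (by
      rw [inner_smul_left, inner_smul_right, real_inner_self_eq_norm_sq, conj_trivial]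
      field_simp
      norm_num)
    rw [inner_smul_right, real_inner_self_eq_norm_sq] at this
    field_simp at this
    exact hpos (by simpa using this)
  have hsa : s.a = 1 := by
    simp only [form, halfVec, hw, inner_smul_left, inner_smul_right, inner_e₀_right,
      conj_trivial, hc0] at hform
    linarith
  have hsb : s.b = v.b := by
    have := hzero ((1 / 2 : ℝ) • e₀ n) (by
      rw [inner_smul_left, inner_smul_right, inner_e₀_left, conj_trivial]
      simp
      norm_num)
    rw [hw, hsa, one_smul] at this
    rw [hb]
    linarith
  ext1
  · rw [hsa]; exact ha.symm
  · exact hsb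
  · rw [hw, hsa, one_smul]

theorem exists_a_eq_one_of_diameter {p : KissingSphere n} (hp : p.diameter = 1) {x : E n}
    (hx : p.tangentPoint = x) : ∃ v, HasLightVec p v ∧ v.a = 1 ∧ v.w = x := by
  obtain ⟨v, hv⟩ := exists_hasLightVec p
  have ht := hv.tangentPoint_eq
  rw [hx, lightPoint] at ht
  split_ifs at ht with ha
  · exact absurd ht (OnePoint.coe_ne_infty _)
  rw [hv.diameter_eq ha, ← ENNReal.ofReal_one,
    ENNReal.ofReal_eq_ofReal_iff (inv_nonneg.2 hv.1.a_nonneg) zero_le_one, inv_eq_one] at hp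
  rw [OnePoint.coe_eq_coe, hp, inv_one, one_smul] at ht
  exact ⟨v, hv, hp, ht.symm⟩

/-- The normalized distance is determined by the Lorentzian form. -/
theorem sq_eq_form_of_isNormalizedDist (hn : 2 ≤ n) {p q : KissingSphere n}
    {v u : InversiveVec n} (hp : HasLightVec p v) (hq : HasLightVec q u) {δ : ℝ}
    (h : IsNormalizedDist p q δ) : δ ^ 2 = v.form u := by
  obtain ⟨T, hT, hlow, p', q', hp', hq', hdp, hdq, x, y, hx, hy, rfl⟩ := h
  obtain ⟨R, hR⟩ := exists_isLift hT
  obtain ⟨v', hv', hva, rfl⟩ := exists_a_eq_one_of_diameter hdp hx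
  obtain ⟨u', hu', hua, rfl⟩ := exists_a_eq_one_of_diameter hdq hy
  -- As the lift fixes `halfVec n`, products with it are kept; this fixes the scale of the images of
  -- the kissing vectors.
  have hhalf : R (halfVec n) = halfVec n := by
    refine eq_halfVec hn ?_ (hR.1 _ _)
    rw [← hR.image_eval_nonpos, ← lowerHalfSpace_eq, hlow]
  have key : ∀ {r r' : KissingSphere n} {s s' : InversiveVec n}, HasLightVec r s →
      HasLightVec r' s' → s'.a = 1 → T '' r.carrier = r'.carrier →
      R (kissVec s) = kissVec s' := by
    intro r r' s s' hs hs' ha hrr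
    refine eq_kissVec hs'.1 ha ?_ ?_
    · rw [← hR.image_eval_eq_zero, ← hs.2, hrr, hs'.2]
    · conv_lhs => rw [← hhalf]
      rw [hR.1, form_kissVec_halfVec hs.1.w_zero]
  have h1 := hR.1 (kissVec v) (kissVec u)
  rw [key hp hv' hva hp', key hq hu' hua hq', form_kissVec hv'.1.w_zero hu'.1.w_zero,
    form_kissVec hp.1.w_zero hq.1.w_zero] at h1
  have h2 : v'.form u' = v.form u := by linarith
  -- For `a = 1` the tangent points are the `w`, and isotropy turns the product into their squared
  -- distance.
  rw [← h2, dist_eq_norm, ← real_inner_self_eq_norm_sq]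
  have h3 := hv'.1.a_mul_b
  have h4 := hu'.1.a_mul_b
  simp only [form, inner_sub_left, inner_sub_right, hva, hua, one_mul,
    real_inner_comm v'.w u'.w] at h3 h4 ⊢
  linarith

/-- If `u.a = 0`, then `u` is constant, and moving along the boundary from the tangent point of `v`
reaches its value. Otherwise a point of the segment between the tangent points, which differ because
the product is nonzero, balances the two squared distances weighted by `v.a` and `u.a`. -/
theorem exists_eval_eq_aux (hn : 2 ≤ n) {v u : InversiveVec n} (hv : IsLight v) (hu : IsLight u)
    (hva : v.a ≠ 0) (hne : v.form u ≠ 0) :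
    ∃ c : E n, c 0 = 0 ∧ v.eval c = u.eval c ∧ 0 < v.eval c := by
  have hapos := hv.a_pos hva
  by_cases hua : u.a = 0
  · have hbpos := hu.b_pos hua
    have h01 : (0 : Fin n) ≠ ⟨1, hn⟩ := by
      rw [Ne, Fin.ext_iff]; simp
    have he : v.eval (v.a⁻¹ • v.w + √(u.b / v.a) • EuclideanSpace.single ⟨1, hn⟩ (1 : ℝ) : E n)
        = u.b := by
      rw [hv.eval_of_a_ne_zero hva, add_sub_cancel_left, inner_smul_left, inner_smul_right,
        conj_trivial, ← mul_assoc (√_), Real.mul_self_sqrt (by positivity)]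
      simp
      field_simp
    refine ⟨_, ?_, he.trans (hu.eval_of_a_eq_zero hua _).symm, he.symm ▸ hbpos⟩
    simp [hv.w_zero, h01]
  · have hapos' := hu.a_pos hua
    set t := v.a⁻¹ • v.w with ht
    set z := u.a⁻¹ • u.w with hz
    have hden : √v.a + √u.a ≠ 0 := by positivity
    set k := √u.a / (√v.a + √u.a) with hk
    set l := √v.a / (√v.a + √u.a) with hl
    have hkl : 1 - k = l := by rw [hk, hl]; field_simp; ring
    have e1 : (t + k • (z - t)) - t = k • (z - t) := by module
    have e2 : (t + k • (z - t)) - z = -(l • (z - t)) := by rw [← hkl]; module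
    have hva' : √v.a ^ 2 = v.a := Real.sq_sqrt hapos.le
    have hua' : √u.a ^ 2 = u.a := Real.sq_sqrt hapos'.le
    have f1 : v.eval (t + k • (z - t) : E n) = v.a * k ^ 2 * ⟪z - t, z - t⟫ := by
      rw [hv.eval_of_a_ne_zero hva, ← ht, e1, inner_smul_left, inner_smul_right, conj_trivial]
      ring
    have f2 : u.eval (t + k • (z - t) : E n) = u.a * l ^ 2 * ⟪z - t, z - t⟫ := by
      rw [hu.eval_of_a_ne_zero hua, ← hz, e2, inner_neg_neg, inner_smul_left, inner_smul_right,
        conj_trivial]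
      ring
    have hzt : 0 < ⟪z - t, z - t⟫ := by
      refine lt_of_le_of_ne real_inner_self_nonneg fun h0 => hne ?_
      have h1 := hv.a_mul_b
      have h2 := hu.a_mul_b
      have : v.form u = v.a * u.a * ⟪z - t, z - t⟫ := by
        simp only [form, ht, hz, inner_sub_left, inner_sub_right, inner_smul_left,
          inner_smul_right, conj_trivial, ← h1, ← h2, real_inner_comm v.w u.w]
        field_simp
        ring
      rw [this, ← h0, mul_zero]
    refine ⟨t + k • (z - t), ?_, ?_, ?_⟩
    · simp [ht, hz, hv.w_zero, hu.w_zero]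
    · rw [f1, f2, hk, hl, div_pow, div_pow, hva', hua']
      ring
    · rw [f1]
      positivity

/-- Two light-like vectors that are not orthogonal take the same positive value at some point of
the boundary. -/
theorem exists_eval_eq (hn : 2 ≤ n) {v u : InversiveVec n} (hv : IsLight v) (hu : IsLight u)
    (hne : v.form u ≠ 0) : ∃ c : E n, c 0 = 0 ∧ v.eval c = u.eval c ∧ 0 < v.eval c := by
  by_cases hva : v.a = 0
  · have hua : u.a ≠ 0 := fun hua => hne (by
      simp [form, hva, hua, hv.w_eq_zero hva])
    obtain ⟨c, h0, h1, h2⟩ := exists_eval_eq_aux hn hu hv hua (by rwa [form_comm])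
    exact ⟨c, h0, h1.symm, h1 ▸ h2⟩
  · exact exists_eval_eq_aux hn hv hu hva hne

theorem inversion_halfVec {c : E n} (hc : c 0 = 0) {r : ℝ} :
    inversion c r (halfVec n) = halfVec n := by
  have : (halfVec n).eval c = 0 := by rw [eval_halfVec_coe, hc]
  ext1 <;> simp only [inversion, this] <;> simp [halfVec]

theorem inversion_kissVec {c : E n} (hc : c 0 = 0) {r : ℝ} (v : InversiveVec n) :
    inversion c r (kissVec v) = kissVec (inversion c r v) := by
  have : (kissVec v).eval c = v.eval c := by rw [eval_kissVec_coe, hc, sub_zero]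
  ext1
  · change (kissVec v).eval c / r ^ 2 = v.eval c / r ^ 2
    rw [this]
  · change v.b + ((kissVec v).eval c / r ^ 2 - v.a) * _ = _
    rw [this]
    rfl
  · change v.w + (1 / 2 : ℝ) • e₀ n + ((kissVec v).eval c / r ^ 2 - v.a) • c =
      v.w + (v.eval c / r ^ 2 - v.a) • c + (1 / 2 : ℝ) • e₀ n
    rw [this]
    abel

theorem IsLight.inversion {v : InversiveVec n} (hv : IsLight v) {c : E n} (hc : c 0 = 0) {r : ℝ}
    (hr : r ≠ 0) (he : v.eval c = r ^ 2) :
    IsLight (v.inversion c r) ∧ (v.inversion c r).a = 1 := by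
  have ha : (v.inversion c r).a = 1 := by
    simp only [InversiveVec.inversion, he]
    field_simp
  have hab : (v.inversion c r).a * (v.inversion c r).b =
      ⟪(v.inversion c r).w, (v.inversion c r).w⟫ := by
    have := form_inversion c hr v v
    rw [hv.form_self] at this
    simp only [form] at this
    linarith
  refine ⟨⟨?_, by rw [ha]; exact zero_le_one, ?_, hab, Or.inl (by rw [ha]; exact one_ne_zero)⟩, ha⟩
  · simp [InversiveVec.inversion, hv.w_zero, hc]
  · rw [ha, one_mul] at hab
    rw [hab]
    exact real_inner_self_nonneg

/-- One inversion normalizes both: its centre is a boundary point where `v` and `u` agree, and the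
square of its radius is their common value there. -/
theorem exists_isNormalizedDist (hn : 2 ≤ n) {p q : KissingSphere n}
    {v u : InversiveVec n} (hp : HasLightVec p v) (hq : HasLightVec q u) (hne : v.form u ≠ 0) :
    ∃ δ, IsNormalizedDist p q δ := by
  obtain ⟨c, hc, heq, hpos⟩ := exists_eval_eq hn hp.1 hq.1 hne
  set r := √(v.eval c) with hr
  have hr0 : r ≠ 0 := (Real.sqrt_pos.2 hpos).ne'
  have hr2 : v.eval c = r ^ 2 := (Real.sq_sqrt hpos.le).symm
  have hL := isLift_sphereInversion c r hr0
  obtain ⟨hv1, hva⟩ := hp.1.inversion hc hr0 hr2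
  obtain ⟨hu1, hua⟩ := hq.1.inversion hc hr0 (heq ▸ hr2)
  have himg : ∀ {s : KissingSphere n} {t : InversiveVec n}, HasLightVec s t →
      sphereInversion c r hr0 '' s.carrier = {y | (kissVec (t.inversion c r)).eval y = 0} := by
    intro s t hst
    rw [hst.2, hL.image_eval_eq_zero, ← inversion_kissVec hc]
    rfl
  have hdiam : ∀ {t : InversiveVec n} (ht : IsLight t), t.a = 1 →
      ht.kissingSphere.diameter = 1 ∧ ht.kissingSphere.tangentPoint = (t.w : EHat n) := by
    intro t ht ha
    have h : HasLightVec ht.kissingSphere t := ⟨ht, rfl⟩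
    rw [h.diameter_eq (by rw [ha]; exact one_ne_zero), h.tangentPoint_eq, lightPoint, ha]
    simp
  refine ⟨_, sphereInversion c r hr0, Subgroup.subset_closure (Or.inl ⟨c, r, hr0, rfl⟩), ?_,
    hv1.kissingSphere, hu1.kissingSphere, himg hp, himg hq, (hdiam hv1 hva).1, (hdiam hu1 hua).1,
    _, _, (hdiam hv1 hva).2, (hdiam hu1 hua).2, rfl⟩
  rw [lowerHalfSpace_eq, hL.image_eval_nonpos]
  change {y | (inversion c r (halfVec n)).eval y ≤ 0} = _
  rw [inversion_halfVec hc]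

theorem dK_nonneg (p q : KissingSphere n) : 0 ≤ dK p q := by
  rw [dK]
  split_ifs with h
  · obtain ⟨_, _, _, _, _, _, _, _, _, x, y, _, _, e⟩ := h.choose_spec
    rw [e]
    exact dist_nonneg
  · exact le_rfl

/-- The distance of kissing spheres in terms of light-like vectors. -/
theorem dK_sq (hn : 2 ≤ n) {p q : KissingSphere n} {v u : InversiveVec n}
    (hp : HasLightVec p v) (hq : HasLightVec q u) : dK p q ^ 2 = v.form u := by
  rw [dK]
  split_ifs with h
  · exact sq_eq_form_of_isNormalizedDist hn hp hq h.choose_spec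
  -- The default value 0 is the right one: normalization can fail only if the product vanishes.
  · rw [zero_pow two_ne_zero]
    by_contra hne
    exact h (exists_isNormalizedDist hn hp hq (Ne.symm hne))

/-! ### Embeddings and the conditions on the matrix -/

theorem determinantCondition_of_embeddable (hn : 2 ≤ n) {I : Type*} [Fintype I] [DecidableEq I]
    {d : I → I → ℝ} (hsymm : ∀ i j, d i j = d j i) (hself : ∀ i, d i i = 0)
    (h : IsometricallyEmbeddable d n) : DeterminantCondition d n := by
  obtain ⟨σ, hσ⟩ := h
  choose v hv using fun i => exists_hasLightVec (σ i)
  have hd : ∀ i j, distMatrix d i j = (v i).form (v j) := fun i j => by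
    rw [← dK_sq hn (hv i) (hv j), hσ]; rfl
  -- The functional is the product with a time-like vector; on its kernel the sums of the `a` and of
  -- the `b` are opposite, so their product is nonpositive.
  refine determinantCondition_of_nonposOnHyperplane hsymm hself
    ⟨fun i => (v i).a + (v i).b, fun x hx => ?_⟩ ?_
  · have hq : x ⬝ᵥ (distMatrix d).mulVec x = 2 * ((∑ i, (v i).a * x i) * ∑ i, (v i).b * x i) -
        2 * ⟪∑ i, x i • (v i).w, ∑ i, x i • (v i).w⟫ := by
      have hw : ⟪∑ i, x i • (v i).w, ∑ i, x i • (v i).w⟫ =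
          ∑ i, ∑ j, x i * x j * ⟪(v i).w, (v j).w⟫ := by
        simp only [sum_inner, inner_sum, inner_smul_left, inner_smul_right, conj_trivial]
        rw [Finset.sum_comm]
        refine Finset.sum_congr rfl fun i _ => ?_
        rw [Finset.mul_sum]
        refine Finset.sum_congr rfl fun j _ => ?_
        ring
      have hx : x ⬝ᵥ (distMatrix d).mulVec x = ∑ i, ∑ j, ((v i).a * x i * ((v j).b * x j) +
          (v i).b * x i * ((v j).a * x j) - 2 * (x i * x j * ⟪(v i).w, (v j).w⟫)) := by
        simp only [dotProduct, Matrix.mulVec, hd, form, Finset.mul_sum]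
        refine Finset.sum_congr rfl fun i _ => Finset.sum_congr rfl fun j _ => ?_
        ring
      rw [hx, hw]
      simp only [Finset.sum_sub_distrib, Finset.sum_add_distrib, ← Finset.mul_sum, ← Finset.sum_mul]
      ring
    have hsum : ∑ i, (v i).a * x i + ∑ i, (v i).b * x i = 0 := by
      rw [← Finset.sum_add_distrib, ← hx]
      exact Finset.sum_congr rfl fun i _ => (add_mul _ _ _).symm
    have h1 := real_inner_self_nonneg (x := ∑ i, x i • (v i).w)
    rw [hq, eq_neg_of_add_eq_zero_right hsum]
    nlinarith [sq_nonneg (∑ i, (v i).a * x i)]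
  -- Since `w 0 = 0`, slot 0 is free to hold `b` (in `Q`, `a`), so the matrix factors through n + 1
  -- coordinates.
  · let P : Matrix I (Option (Fin n)) ℝ := Matrix.of fun i k => k.elim (v i).a fun k =>
      if k = 0 then (v i).b else -2 * (v i).w k
    let Q : Matrix (Option (Fin n)) I ℝ := Matrix.of fun k i => k.elim (v i).b fun k =>
      if k = 0 then (v i).a else (v i).w k
    have hPQ : distMatrix d = P * Q := by
      ext i j
      have h1 : ∀ k ∈ Finset.univ.erase (0 : Fin n),
          P i (some k) * Q (some k) j = -2 * ((v i).w k * (v j).w k) := fun k hk => by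
        have hk0 := Finset.ne_of_mem_erase hk
        simp only [P, Q, Matrix.of_apply, Option.elim, if_neg hk0]
        ring
      have h2 : ⟪(v i).w, (v j).w⟫ = ∑ k ∈ Finset.univ.erase (0 : Fin n),
          (v i).w k * (v j).w k := by
        rw [PiLp.inner_apply, ← Finset.add_sum_erase _ _ (Finset.mem_univ (0 : Fin n)),
          (hv i).1.w_zero, inner_zero_left, zero_add]
        exact Finset.sum_congr rfl fun k _ => mul_comm _ _
      rw [hd, Matrix.mul_apply, Fintype.sum_option,
        ← Finset.add_sum_erase _ _ (Finset.mem_univ (0 : Fin n)), Finset.sum_congr rfl h1,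
        ← Finset.mul_sum, ← h2]
      simp only [P, Q, form, Matrix.of_apply, Option.elim, if_true]
      ring
    rw [hPQ]
    refine (Matrix.rank_mul_le_left P Q).trans ((Matrix.rank_le_card_width P).trans ?_)
    simp

theorem embeddable_of_light (hn : 2 ≤ n) {I : Type*} {d : I → I → ℝ}
    (hnonneg : ∀ i j, 0 ≤ d i j) {v : I → InversiveVec n} (hv : ∀ i, IsLight (v i))
    (h : ∀ i j, d i j ^ 2 = (v i).form (v j)) : IsometricallyEmbeddable d n := by
  refine ⟨fun i => (hv i).kissingSphere, fun i j => ?_⟩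
  rw [← sq_eq_sq₀ (dK_nonneg _ _) (hnonneg i j), h]
  exact dK_sq hn ⟨hv i, rfl⟩ ⟨hv j, rfl⟩

theorem embeddable_of_eigenvalueCondition (hn : 2 ≤ n) {I : Type*} [Fintype I] [DecidableEq I]
    {d : I → I → ℝ} (hnonneg : ∀ i j, 0 ≤ d i j) (hsymm : ∀ i j, d i j = d j i)
    (hself : ∀ i, d i i = 0) (hne : ∀ i, ∃ j, d i j ≠ 0)
    (h : EigenvalueCondition d hsymm n) : IsometricallyEmbeddable d n := by
  obtain ⟨a', z', h'⟩ := exists_lorentzian_gram (distMatrix_isHermitian d hsymm) h.1 h.2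
  obtain ⟨a, z, ha, hd⟩ := exists_future_gram (A := fun i j => d i j ^ 2)
    (fun i j => sq_nonneg _) (fun i => by simp [hself])
    (fun i => (hne i).imp fun j hj => pow_ne_zero 2 hj) h'
  have hz : ∀ i, ⟪z i, z i⟫ = a i ^ 2 := fun i => by
    have := hd i i
    simp only [hself] at this
    linarith
  have hz0 : ∀ i, |z i 0| ≤ a i := fun i => by
    have h1 : |z i 0| ≤ ‖z i‖ := by simpa using PiLp.norm_apply_le (z i) 0
    rwa [norm_eq_sqrt_real_inner, hz, Real.sqrt_sq (ha i).le] at h1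
  have hinner : ∀ i j, ⟪z i - z i 0 • e₀ n, z j - z j 0 • e₀ n⟫ = ⟪z i, z j⟫ - z i 0 * z j 0 := by
    intro i j
    simp only [inner_sub_left, inner_sub_right, inner_smul_left, inner_smul_right, inner_e₀_left,
      inner_e₀_right, conj_trivial]
    simp
  -- Light-cone coordinates: `a ± z 0` become the two isotropic coordinates, and the rest of `z` is
  -- orthogonal to `e₀ n`.
  refine embeddable_of_light hn hnonneg
    (v := fun i => ⟨a i + z i 0, a i - z i 0, z i - z i 0 • e₀ n⟩) (fun i => ?_) fun i j => ?_
  · have := abs_le.1 (hz0 i)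
    refine ⟨by simp, by simp only; linarith, by simp only; linarith, ?_, ?_⟩
    · simp only [hinner, hz]; ring
    · by_contra! hc
      simp only at hc
      linarith [ha i, hc.1, hc.2]
  · rw [hd, form, hinner]
    ring

end KissingSpheres

open KissingSpheres in
theorem theorem3p1 (n : ℕ) [NeZero n] (hn : 2 ≤ n)
    {I : Type*} [Fintype I] [DecidableEq I] [Nonempty I] (d : I → I → ℝ)
    (hnonneg : ∀ i j, 0 ≤ d i j) (hsymm : ∀ i j, d i j = d j i) (hself : ∀ i, d i i = 0) :
    ((∀ i, ∃ j, d i j ≠ 0) →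
      List.TFAE [IsometricallyEmbeddable d n, DeterminantCondition d n,
        EigenvalueCondition d hsymm n]) ∧
    (IsometricallyEmbeddable d n → DeterminantCondition d n) ∧
    ((∃ i j, d i j ≠ 0) → (DeterminantCondition d n ↔ EigenvalueCondition d hsymm n)) ∧
    ((∀ i j, d i j = 0) → IsometricallyEmbeddable d n ∧ DeterminantCondition d n) := by
  have h12 := determinantCondition_of_embeddable (n := n) hn hsymm hself
  have h23 := eigenvalueCondition_of_determinantCondition (n := n) hsymm hself
  have h32 := determinantCondition_of_eigenvalueCondition (n := n) hsymm hself
  refine ⟨fun hne => ?_, h12, fun hne => ⟨h23 hne, h32⟩, fun hzero => ?_⟩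
  · obtain ⟨i⟩ := ‹Nonempty I›
    have h31 := embeddable_of_eigenvalueCondition hn hnonneg hsymm hself hne
    tfae_have 1 → 2 := h12
    tfae_have 2 → 3 := h23 ⟨i, hne i⟩
    tfae_have 3 → 1 := h31
    tfae_finish
  -- The constant map to the hyperplane `x 0 = 1`, tangent at infinity, realizes the zero function.
  · have hv : IsLight (⟨0, 1, 0⟩ : InversiveVec n) :=
      ⟨by simp, le_rfl, zero_le_one, by simp, Or.inr one_ne_zero⟩
    have he : IsometricallyEmbeddable d n :=
      embeddable_of_light hn hnonneg (fun _ => hv) fun i j => by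
        rw [hv.form_self, hzero, zero_pow two_ne_zero]
    exact ⟨he, h12 he⟩
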